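/- **Setting.** Let $\mu>0$, $0<b<1/\sqrt2$, let $M=\mathbb R\times[-1,1]$ with $(t,-1)\equiv(t,1)$ be the infinite cylinder, $\mathcal F=C_c^\infty(M,\mathbb C)$ and $\mathcal I_b=\{n\in\mathbb Z:|n|<1/(\sqrt2\,b)\}$. For $\operatorname{Re}\tau\ge 0$ and $x\in\mathbb R$ let, with the principal logarithm, $$g(\tau,x)=-\tfrac{\pi\tau}{2}-\tfrac12\log(1-e^{-\pi\tau+\pi i x})-\tfrac12\log(1-e^{-\pi\tau-\pi i x}).$$ *Correlators.* Let $k\ge1$, $u_j=(t_j,x_j)\in M$ and $\alpha_j=bn_j$ with $n_j\in\mathcal I_b$ for $1\le j\le k$, and $w=-\sum_j n_j$. Let $\gamma$ be the contour which comes in horizontally from $it_1-\infty$ to $it_1$, moves vertically to $it_2$, then to $it_3$, and so on until $it_k$, and leaves horizontally to $it_k+\infty$. For two points $u,u'$ of $\gamma\times[-1,1]$, let $\mathcal T(u-u')$ be the later one along $\gamma$ minus the earlier one, where the points $v_j=(it_j,x_j)$ are visited in the order of their labels. If $w\ge0$, put $$C^{\mathrm L}_{b\boldsymbol n}(u_1,\dots,u_k)=\frac{(-\mu)^w}{w!}\,e^{-4\sum_{j<j'}\alpha_j\alpha_{j'}g(\mathcal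 T(v_j-v_{j'}))}\int_{(\gamma\times[-1,1])^w}e^{-4b\sum_{j,l}\alpha_j g(\mathcal T(v_j-z_l))-4b^2\sum_{l<l'}g(\mathcal T(z_l-z_{l'}))}\,dz_1\cdots dz_w,$$ a contour integral in the first coordinate and a Lebesgue integral in the second coordinate of each $z_l$; if $w<0$, put $C^{\mathrm L}_{b\boldsymbol n}=0$. *Algebra and vacuum functional.* Let $\mathcal A$ be the tensor algebra of $\bigoplus_{n\in\mathcal I_b}\mathcal G_n$, where $\mathcal G_n=\{\mathcal O_{f,n}:f\in\mathcal F\}$ is a copy of $\mathcal F$, with the conjugate-linear, anti-multiplicative involution determined by $\mathcal O_{f,n}^*=\mathcal O_{\bar f,n}$. Let $\omega:\mathcal A\to\mathbb C$ be the linear functional with $\omega(1)=1$ and $$\omega(\mathcal O_{f_1,n_1}\cdots\mathcal O_{f_k,n_k})=\int_{M^k}\prod_{j=1}^k f_j(u_j)\;C^{\mathrm L}_{b\boldsymbol n}(u_1,\dots,u_k)\,du_1\cdots du_k .$$ (These integrals are absolutely convergent. That fact is not part of the assertion below: formally, $\omega$ is given the value $0$ on the products with charges $\boldsymbol n$ if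 the integrals for $\boldsymbol n$ are not all absolutely convergent.) *State space.* Let $\Phi(A)=(\omega(B^*A))_{B\in\mathcal A}\in\mathbb C^{\mathcal A}$, let $\mathcal H_0=\Phi(\mathcal A)$, and let $\mathcal H$ be the closure of $\mathcal H_0$ in $\mathbb C^{\mathcal A}$ for the product topology. Let $\Omega=\Phi(1)$. **Theorem.** The pairing $(\Phi(A),z):=z_A$ for $A\in\mathcal A$, $z\in\mathcal H$ is well defined on $\mathcal H_0\times\mathcal H$. For $C\in\mathcal A$, the formula $\pi(C)(z_A)_{A\in\mathcal A}=(z_{C^*A})_{A\in\mathcal A}$ defines a continuous linear map $\pi(C):\mathcal H\to\mathcal H$, and $\pi$ is a unital algebra representation of $\mathcal A$ on $\mathcal H$. Moreover: 1. $\pi(C)$ preserves $\mathcal H_0$, and $\pi(C)\Phi(A)=\Phi(CA)$ for all $A,C\in\mathcal A$. 2. $(\pi(C)u,z)=(u,\pi(C^*)z)$ for all $C\in\mathcal A$, $u\in\mathcal H_0$, $z\in\mathcal H$. 3. $\operatorname{span}\{\pi(C)\Omega:C\in\mathcal A\}=\mathcal H_0$, which is dense in $\mathcal H$; thus $\Omega$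 is cyclic. 4. $\omega(A)=(\Omega,\pi(A)\Omega)$ for all $A\in\mathcal A$. -/

import Mathlib

open scoped DirectSum TensorProduct ContDiff

noncomputable section

namespace TimelikeLiouville

/-! ### The cylinder and its test functions -/

/-- The infinite cylinder `M = ℝ × [-1,1]` with `(t,-1)` and `(t,1)` identified. -/
abbrev Cyl : Type := ℝ × AddCircle (2 : ℝ)

/-- The projection of the universal cover `ℝ × ℝ` onto the cylinder. -/
def cylProj (p : ℝ × ℝ) : Cyl := (p.1, (p.2 : AddCircle (2 : ℝ)))

/-- Lebesgue measure on the fundamental domain `ℝ × [-1,1]`. -/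
def cylMeasure : MeasureTheory.Measure (ℝ × ℝ) :=
  MeasureTheory.volume.restrict (Set.univ ×ˢ Set.Icc (-1 : ℝ) 1)

/-- `C_c^∞(M, ℂ)`: compactly supported functions on the cylinder whose lift to the universal cover
is smooth. -/
def TestFn : Submodule ℂ (Cyl → ℂ) where
  carrier := {f | ContDiff ℝ ∞ (fun p : ℝ × ℝ => f (cylProj p)) ∧ HasCompactSupport f}
  add_mem' := fun hf hg => ⟨hf.1.add hg.1, hf.2.add hg.2⟩
  zero_mem' := ⟨contDiff_const, HasCompactSupport.zero⟩
  smul_mem' := fun c _ hf => ⟨contDiff_const.smul hf.1, hf.2.smul_left (f := fun _ => c)⟩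

/-- Complex conjugation of test functions. -/
def conjTest (f : TestFn) : TestFn :=
  ⟨fun u => starRingEnd ℂ (f.1 u), Complex.conjCLE.contDiff.comp f.2.1,
    f.2.2.comp_left (g := starRingEnd ℂ) (map_zero _)⟩

/-! ### The Lorentzian correlators -/

/-- The Green's function `g(τ,x)` of the cylinder, continued to `Re τ ≥ 0`. -/
def green (τ : ℂ) (x : ℝ) : ℂ :=
  -(Real.pi * τ) / 2
    - Complex.log (1 - Complex.exp (-(Real.pi * τ) + Real.pi * Complex.I * x)) / 2
    - Complex.log (1 - Complex.exp (-(Real.pi * τ) - Real.pi * Complex.I * x)) / 2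

/-- `g(𝒯(u - u'))` for `u = (τ,x)` and `u' = (τ',x')` with contour parameters `s` and `s'`: the
point which is later along the contour comes first in the difference. -/
def orderedGreen (s s' : ℝ) (τ τ' : ℂ) (x x' : ℝ) : ℂ :=
  if s' ≤ s then green (τ - τ') (x - x') else green (τ' - τ) (x' - x)

/-- The `j`-th time, and `0` when there are not that many. -/
def timeAt {k : ℕ} (t : Fin k → ℝ) (j : ℕ) : ℝ := if h : j < k then t ⟨j, h⟩ else 0

/-- The contour which comes in horizontally from `i t₀ - ∞` to `i t₀`, moves vertically to `i t₁`,
then to `i t₂`, and so on until `i t_{k-1}`, and leaves horizontally to `i t_{k-1} + ∞`, for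
`k ≥ 1`. It is parametrized so that it is at `i t_j` when the parameter is `j` and affine
in between. -/
def contour {k : ℕ} (t : Fin k → ℝ) (s : ℝ) : ℂ :=
  ((min s 0 + max (s - ((k : ℝ) - 1)) 0 : ℝ) : ℂ) +
    Complex.I * ((timeAt t 0 + ∑ j ∈ Finset.range (k - 1),
      (timeAt t (j + 1) - timeAt t j) * max 0 (min 1 (s - j)) : ℝ) : ℂ)

/-- The integrand of the screening integral, at external insertions with charges `α j`, times `t j`
and positions `x j`, and screening points with contour parameters `(p l).1` and positions
`(p l).2`, including the factors `γ'(s_l)` of the contour integral. -/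
def screeningIntegrand (b : ℝ) {k w : ℕ} (α : Fin k → ℂ) (t x : Fin k → ℝ)
    (p : Fin w → ℝ × ℝ) : ℂ :=
  Complex.exp
    (-4 * b * ∑ j : Fin k, ∑ l : Fin w, α j *
        orderedGreen (j : ℕ) (p l).1 (Complex.I * t j) (contour t (p l).1) (x j) (p l).2
      - 4 * b ^ 2 * ∑ l : Fin w, ∑ l' ∈ Finset.Ioi l,
        orderedGreen (p l).1 (p l').1 (contour t (p l).1) (contour t (p l').1) (p l).2 (p l').2)
  * ∏ l : Fin w, deriv (contour t) (p l).1

/-- The Lorentzian correlator `C^L_{α₁,…,α_k}` with `w` screening charges. -/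
def lorentzCorr (b μ : ℝ) {k : ℕ} (w : ℕ) (α : Fin k → ℂ) (t x : Fin k → ℝ) : ℂ :=
  (-(μ : ℂ)) ^ w / (w.factorial : ℂ) *
    Complex.exp (-4 * ∑ j : Fin k, ∑ j' ∈ Finset.Ioi j, α j * α j' *
      orderedGreen (j : ℕ) (j' : ℕ) (Complex.I * t j) (Complex.I * t j') (x j) (x j')) *
    ∫ p : Fin w → ℝ × ℝ, screeningIntegrand b α t x p
      ∂(MeasureTheory.Measure.pi fun _ => cylMeasure)

/-- The set `ℐ_b` of integer charges. -/
abbrev Charge (b : ℝ) : Type := {n : ℤ // |(n : ℝ)| < 1 / (Real.sqrt 2 * b)}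

instance (b : ℝ) : Finite (Charge b) := by
  refine Set.Finite.to_subtype
    ((Set.finite_Icc (-⌈1 / (Real.sqrt 2 * b)⌉) ⌈1 / (Real.sqrt 2 * b)⌉).subset ?_)
  intro n hn
  have h : |(n : ℝ)| ≤ (⌈1 / (Real.sqrt 2 * b)⌉ : ℝ) :=
    (le_of_lt hn).trans (Int.le_ceil _)
  have h2 : |n| ≤ ⌈1 / (Real.sqrt 2 * b)⌉ := by exact_mod_cast h
  exact abs_le.mp h2

instance (b : ℝ) : Fintype (Charge b) := Fintype.ofFinite _

/-- The Lorentzian correlator with charges `b n_j`, which vanishes when the screening number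
`w = -∑ n_j` is negative. The point `u j` is `(t_j, x_j)`. -/
def chargeCorr (b μ : ℝ) {k : ℕ} (n : Fin k → Charge b) (u : Fin k → ℝ × ℝ) : ℂ :=
  if 0 ≤ -∑ j, (n j : ℤ) then
    lorentzCorr b μ (-∑ j, (n j : ℤ)).toNat (fun j => ((b * (n j : ℤ) : ℝ) : ℂ))
      (fun j => (u j).1) (fun j => (u j).2)
  else 0

/-- The integrand of the smeared correlator. -/
def smearedIntegrand (b μ : ℝ) {k : ℕ} (n : Fin k → Charge b) (f : Fin k → TestFn)
    (u : Fin k → ℝ × ℝ) : ℂ :=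
  (∏ j, (f j).1 (cylProj (u j))) * chargeCorr b μ n u

/-- Product Lebesgue measure on `M^k`. -/
def cylPow (k : ℕ) : MeasureTheory.Measure (Fin k → ℝ × ℝ) :=
  MeasureTheory.Measure.pi fun _ => cylMeasure

lemma smearedIntegrand_update_add (b μ : ℝ) {k : ℕ} (n : Fin k → Charge b) [DecidableEq (Fin k)]
    (f : Fin k → TestFn) (i : Fin k) (g h : TestFn) :
    smearedIntegrand b μ n (Function.update f i (g + h)) =
      smearedIntegrand b μ n (Function.update f i g)
        + smearedIntegrand b μ n (Function.update f i h) := by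
  funext u
  have key : ∀ g : TestFn, (∏ j, (Function.update f i g j).1 (cylProj (u j))) =
      g.1 (cylProj (u i)) * ∏ j ∈ Finset.univ.erase i, (f j).1 (cylProj (u j)) := by
    intro g
    rw [← Finset.mul_prod_erase _ _ (Finset.mem_univ i), Function.update_self]
    congr 1
    refine Finset.prod_congr rfl fun j hj => ?_
    rw [Function.update_of_ne (Finset.ne_of_mem_erase hj)]
  simp only [smearedIntegrand, key, Pi.add_apply, Submodule.coe_add]
  ring

lemma smearedIntegrand_update_smul (b μ : ℝ) {k : ℕ} (n : Fin k → Charge b) [DecidableEq (Fin k)]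
    (f : Fin k → TestFn) (i : Fin k) (c : ℂ) (g : TestFn) :
    smearedIntegrand b μ n (Function.update f i (c • g)) =
      c • smearedIntegrand b μ n (Function.update f i g) := by
  funext u
  have key : ∀ g : TestFn, (∏ j, (Function.update f i g j).1 (cylProj (u j))) =
      g.1 (cylProj (u i)) * ∏ j ∈ Finset.univ.erase i, (f j).1 (cylProj (u j)) := by
    intro g
    rw [← Finset.mul_prod_erase _ _ (Finset.mem_univ i), Function.update_self]
    congr 1
    refine Finset.prod_congr rfl fun j hj => ?_
    rw [Function.update_of_ne (Finset.ne_of_mem_erase hj)]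
  simp only [smearedIntegrand, key, Pi.smul_apply, Submodule.coe_smul, smul_eq_mul]
  ring

open Classical in
/-- The smeared correlator `⟨𝒪_{f₁,n₁} ⋯ 𝒪_{f_k,n_k}⟩ = ∫_{M^k} ∏ f_j(u_j) C^L_{bn}(u) du`, as a
multilinear function of the test functions. As for the Bochner integral itself, the value is `0`
by convention if these integrals are not absolutely convergent. -/
def smearedCorr (b μ : ℝ) {k : ℕ} (n : Fin k → Charge b) :
    MultilinearMap ℂ (fun _ : Fin k => TestFn) ℂ :=
  if hint : ∀ f, MeasureTheory.Integrable (smearedIntegrand b μ n f) (cylPow k) then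
    { toFun := fun f => ∫ u, smearedIntegrand b μ n f u ∂(cylPow k)
      map_update_add' := by
        intro _ f i g h
        rw [smearedIntegrand_update_add]
        exact MeasureTheory.integral_add (hint _) (hint _)
      map_update_smul' := by
        intro _ f i c g
        rw [smearedIntegrand_update_smul]
        exact MeasureTheory.integral_smul c _ }
  else 0

/-! ### The observable algebra, its involution, and the vacuum functional -/

/-- The space of generators `𝒢 = ⨁_n 𝒢_n`, one copy of the test functions for each of the finitely
many charges. -/
abbrev Gen (b : ℝ) : Type := Charge b → TestFn

/-- The algebra `𝒜 = T(𝒢)` of ordered products of smeared observables. -/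
abbrev ObsAlg (b : ℝ) : Type := TensorAlgebra ℂ (Gen b)

/-- The basic smeared observable `𝒪_{f,n}`. -/
def obs {b : ℝ} (f : TestFn) (n : Charge b) : ObsAlg b :=
  TensorAlgebra.ι ℂ (Pi.single n f)

/-- The opposite algebra of `𝒜`, on which complex scalars act through their conjugates. -/
def ConjOp (b : ℝ) : Type := (ObsAlg b)ᵐᵒᵖ

instance (b : ℝ) : Ring (ConjOp b) := inferInstanceAs (Ring (ObsAlg b)ᵐᵒᵖ)

instance (b : ℝ) : Algebra ℂ (ConjOp b) :=
  ((algebraMap ℂ (ObsAlg b)ᵐᵒᵖ).comp (starRingEnd ℂ)).toAlgebra' (fun c x =>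
    Algebra.commutes (A := (ObsAlg b)ᵐᵒᵖ) (starRingEnd ℂ c) x)

/-- `𝒪_{f,n} ↦ 𝒪_{f̄,n}` on generators, with values in the conjugate opposite algebra. -/
def genStar (b : ℝ) : Gen b →ₗ[ℂ] ConjOp b where
  toFun g := MulOpposite.op (TensorAlgebra.ι ℂ (fun n => conjTest (g n)))
  map_add' g h := by
    have : (fun n => conjTest ((g + h) n)) = (fun n => conjTest (g n)) + fun n => conjTest (h n) := by
      funext n; apply Subtype.ext; funext u; simp [conjTest]
    rw [this, map_add]; rfl
  map_smul' c g := by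
    have : (fun n => conjTest ((c • g) n)) = (starRingEnd ℂ c) • fun n => conjTest (g n) := by
      funext n; apply Subtype.ext; funext u; simp [conjTest]
    rw [this, map_smul, Algebra.smul_def, MulOpposite.op_mul, RingHom.id_apply]
    exact (Algebra.commutes (A := (ObsAlg b)ᵐᵒᵖ) (starRingEnd ℂ c) _).symm

/-- The involution of `𝒜`: the conjugate-linear, anti-multiplicative extension of
`𝒪_{f,n}^* = 𝒪_{f̄,n}`. -/
instance (b : ℝ) : Star (ObsAlg b) where
  star A := MulOpposite.unop (TensorAlgebra.lift ℂ (genStar b) A : (ObsAlg b)ᵐᵒᵖ)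

lemma star_obs {b : ℝ} (f : TestFn) (n : Charge b) :
    star (obs f n : ObsAlg b) = obs (conjTest f) n := by
  change MulOpposite.unop (TensorAlgebra.lift ℂ (genStar b) (TensorAlgebra.ι ℂ (Pi.single n f))) = _
  rw [TensorAlgebra.lift_ι_apply]
  change TensorAlgebra.ι ℂ _ = TensorAlgebra.ι ℂ _
  congr 1
  funext m
  by_cases h : m = n
  · subst h; simp
  · rw [Pi.single_eq_of_ne h, Pi.single_eq_of_ne h]
    apply Subtype.ext; funext u; simp [conjTest]

lemma star_mul_obsAlg {b : ℝ} (A B : ObsAlg b) : star (A * B) = star B * star A := by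
  change MulOpposite.unop (TensorAlgebra.lift ℂ (genStar b) (A * B) : (ObsAlg b)ᵐᵒᵖ) = _
  rw [map_mul]; rfl

lemma star_add_obsAlg {b : ℝ} (A B : ObsAlg b) : star (A + B) = star A + star B := by
  change MulOpposite.unop (TensorAlgebra.lift ℂ (genStar b) (A + B) : (ObsAlg b)ᵐᵒᵖ) = _
  rw [map_add]; rfl

lemma star_algebraMap_obsAlg {b : ℝ} (c : ℂ) :
    star (algebraMap ℂ (ObsAlg b) c) = algebraMap ℂ (ObsAlg b) (starRingEnd ℂ c) := by
  change MulOpposite.unop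
    (TensorAlgebra.lift ℂ (genStar b) (algebraMap ℂ (ObsAlg b) c) : (ObsAlg b)ᵐᵒᵖ) = _
  rw [AlgHom.commutes]; rfl

/-- The part of the vacuum functional on products of `k` generators. -/
def vacuumDeg (b μ : ℝ) (k : ℕ) : MultilinearMap ℂ (fun _ : Fin k => Gen b) ℂ :=
  ∑ n : Fin k → Charge b,
    (smearedCorr b μ n).compLinearMap (fun j => LinearMap.proj (n j))

/-- The vacuum functional `ω : 𝒜 → ℂ`, the linear extension of
`ω(𝒪_{f₁,n₁} ⋯ 𝒪_{f_k,n_k}) = ⟨𝒪_{f₁,n₁} ⋯ 𝒪_{f_k,n_k}⟩` (and `ω(1) = 1`, the case `k = 0`). -/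
def vacuum (b μ : ℝ) : ObsAlg b →ₗ[ℂ] ℂ :=
  DirectSum.toModule ℂ ℕ ℂ (fun k => PiTensorProduct.lift (vacuumDeg b μ k)) ∘ₗ
    (TensorAlgebra.equivDirectSum (R := ℂ) (M := Gen b)).toLinearMap

/-- `ω` on ordered products of basic observables. -/
lemma vacuum_obs_prod (b μ : ℝ) {k : ℕ} (f : Fin k → TestFn) (n : Fin k → Charge b)
    (hint : ∀ f, MeasureTheory.Integrable (smearedIntegrand b μ n f) (cylPow k)) :
    vacuum b μ (List.ofFn fun j => obs (f j) (n j)).prod =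
      ∫ u, smearedIntegrand b μ n f u ∂(cylPow k) := by
  have h1 : vacuum b μ (List.ofFn fun j => obs (f j) (n j)).prod = smearedCorr b μ n f := by
    have h2 : (List.ofFn fun j => obs (f j) (n j)).prod =
        TensorAlgebra.tprod ℂ (Gen b) k (fun j => Pi.single (n j) (f j)) := by
      rw [TensorAlgebra.tprod_apply]; rfl
    have h3 : TensorAlgebra.equivDirectSum (TensorAlgebra.tprod ℂ (Gen b) k
        (fun j => Pi.single (n j) (f j))) = DirectSum.of (fun k => ⨂[ℂ]^k (Gen b)) k
          (PiTensorProduct.tprod ℂ fun j => Pi.single (n j) (f j)) :=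
      TensorAlgebra.toDirectSum_tensorPower_tprod _
    rw [h2, vacuum, LinearMap.comp_apply, AlgEquiv.toLinearMap_apply, h3,
      ← DirectSum.lof_eq_of ℂ, DirectSum.toModule_lof, PiTensorProduct.lift.tprod, vacuumDeg,
      sum_apply, Finset.sum_eq_single n]
    · simp only [MultilinearMap.compLinearMap_apply, LinearMap.proj_apply, Pi.single_eq_same]
    · intro m _ hm
      obtain ⟨j, hj⟩ := Function.ne_iff.mp hm
      rw [MultilinearMap.compLinearMap_apply]
      exact MultilinearMap.map_coord_zero _ j (by simp [Pi.single_eq_of_ne hj])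
    · simp
  rw [h1, smearedCorr, dif_pos hint]
  rfl

/-- `ω(1) = 1`. -/
lemma vacuum_one (b μ : ℝ) : vacuum b μ 1 = 1 := by
  have hI : ∀ (n : Fin 0 → Charge b) (f : Fin 0 → TestFn),
      smearedIntegrand b μ n f = fun _ => 1 := by
    intro n f
    funext u
    have h0 : (-∑ j, (n j : ℤ)).toNat = 0 := by simp
    rw [smearedIntegrand, chargeCorr, if_pos (by simp), h0]
    rw [lorentzCorr, MeasureTheory.Measure.pi_of_empty]
    simp [screeningIntegrand]
  have h := vacuum_obs_prod b μ (k := 0) (fun i => i.elim0) (fun i => i.elim0) (fun f => by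
    rw [hI, cylPow, MeasureTheory.Measure.pi_of_empty]
    exact MeasureTheory.integrable_const _)
  rw [hI, cylPow, MeasureTheory.Measure.pi_of_empty] at h
  simpa using h

/-! ### The state space -/

/-- `Φ(A) = (ω(B^* A))_B`, as a linear map to `ℂ^𝒜`. -/
def coeffMap (b μ : ℝ) : ObsAlg b →ₗ[ℂ] (ObsAlg b → ℂ) :=
  LinearMap.pi fun B => vacuum b μ ∘ₗ LinearMap.mulLeft ℂ (star B)

/-- The state space `ℋ`: the closure of `Φ(𝒜)` in `ℂ^𝒜` for the product topology. -/
def stateSpace (b μ : ℝ) : Submodule ℂ (ObsAlg b → ℂ) :=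
  (LinearMap.range (coeffMap b μ)).topologicalClosure

/-- `Φ`, as a map to `ℋ`. -/
def stateVec (b μ : ℝ) : ObsAlg b →ₗ[ℂ] stateSpace b μ :=
  (coeffMap b μ).codRestrict _ fun A =>
    Submodule.le_topologicalClosure _ (LinearMap.mem_range_self _ A)

/-- The dense core `ℋ₀ = Φ(𝒜)`, as a subspace of `ℋ`. -/
def core (b μ : ℝ) : Submodule ℂ (stateSpace b μ) := LinearMap.range (stateVec b μ)

/-- `Φ`, as a map to `ℋ₀`. -/
def coreVec (b μ : ℝ) (A : ObsAlg b) : core b μ := ⟨stateVec b μ A, LinearMap.mem_range_self _ A⟩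

/-- The pairing `ℋ₀ × ℋ → ℂ`, `(Φ(A), z) = z_A`, computed from some `A` representing the first
argument. -/
def pairing {b μ : ℝ} (u : core b μ) (z : stateSpace b μ) : ℂ :=
  (z : ObsAlg b → ℂ) (Classical.choose (LinearMap.mem_range.mp u.2))

/-- The vacuum vector `Ω = Φ(1)`. -/
def vacuumVec (b μ : ℝ) : core b μ := coreVec b μ 1

end TimelikeLiouville

end

open TimelikeLiouville

namespace TimelikeLiouville

open ComplexConjugate

/-! ### Reflection symmetry of the correlators -/

/-! The only analytic input is the hermiticity `ω(A*) = conj ω(A)` (`vacuum_star`). It gives `Φ(C)_A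
= conj Φ(A)_C`, so on `ℋ₀` the coordinate at `A` depends only on `Φ(A)`; equality of two coordinates
is a closed condition, so this extends to `ℋ`, and the pairing is well defined
(`stateSpace_apply_congr`). Everything else is algebra of the shifts `z ↦ (z_{C*A})_A`. No
positivity of `ω` enters.

Hermiticity comes from the reflection `τ ↦ -conj τ`. It carries the contour through `t₁,…,t_k` to
the one through `t_k,…,t₁`, traversed backwards (`contour_rev`). Since the order is reversed too,
each ordered difference is conjugated, up to the sign of its spatial part, and `green` is even in
`x` and commutes with conjugation on `Re τ ≥ 0`. So reversing the insertions conjugates the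
correlator (`chargeCorr_rev`).

Convergence is never needed: conjugation and measure-preserving bijections commute with the Bochner
integral unconditionally, and absolute convergence for charges `n` is equivalent to that for the
reversed charges. -/

lemma green_neg (τ : ℂ) (x : ℝ) : green τ (-x) = green τ x := by
  simp only [green, Complex.ofReal_neg, mul_neg, sub_neg_eq_add, ← sub_eq_add_neg]
  ring

/-- Conjugation fails to commute with the principal logarithm only on the negative real axis, which
`1 - z` avoids because its real part is nonnegative. -/
lemma log_one_sub_conj {z : ℂ} (hz : ‖z‖ ≤ 1) :
    conj (Complex.log (1 - z)) = Complex.log (1 - conj z) := by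
  rw [← Complex.log_conj, map_sub, map_one]
  intro h
  obtain ⟨h1, -⟩ := Complex.arg_eq_pi_iff.mp h
  have h2 := (Complex.re_le_norm z).trans hz
  simp only [Complex.sub_re, Complex.one_re] at h1
  linarith

lemma green_conj {τ : ℂ} (hτ : 0 ≤ τ.re) (x : ℝ) : conj (green τ x) = green (conj τ) x := by
  have hn : ∀ y : ℝ, ‖Complex.exp (-(Real.pi * τ) + Real.pi * Complex.I * y)‖ ≤ 1 := by
    intro y
    rw [Complex.norm_exp, Real.exp_le_one_iff]
    simp only [Complex.add_re, Complex.neg_re, Complex.mul_re, Complex.ofReal_re,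
      Complex.ofReal_im, Complex.I_re, Complex.I_im, Complex.mul_im]
    nlinarith [mul_nonneg Real.pi_pos.le hτ]
  have hn' : ‖Complex.exp (-(Real.pi * τ) - Real.pi * Complex.I * x)‖ ≤ 1 := by
    simpa [sub_eq_add_neg] using hn (-x)
  simp only [green, map_sub, map_div₀, log_one_sub_conj (hn x), log_one_sub_conj hn',
    ← Complex.exp_conj, map_add, map_neg, map_mul, Complex.conj_ofReal, Complex.conj_I,
    Complex.conj_ofNat, mul_neg, neg_mul, sub_neg_eq_add, ← sub_eq_add_neg]
  ring

lemma orderedGreen_swap {s s' : ℝ} {τ τ' : ℂ} (h : s = s' → τ = τ') (x x' : ℝ) :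
    orderedGreen s' s τ' τ x' x = orderedGreen s s' τ τ' x x' := by
  rcases lt_trichotomy s s' with h1 | h1 | h1
  · simp [orderedGreen, h1.le, h1.not_ge]
  · obtain rfl := h h1
    subst h1
    simp only [orderedGreen, le_refl, if_true, sub_self]
    rw [← green_neg, neg_sub]
  · simp [orderedGreen, h1.le, h1.not_ge]

/-- Reflecting the contour parameters and the times `τ ↦ -τ̄` conjugates the ordered Green's
function. -/
lemma orderedGreen_reflect {s s' : ℝ} {τ τ' : ℂ} (h : s ≤ s' → τ.re ≤ τ'.re)
    (h' : s' ≤ s → τ'.re ≤ τ.re) (heq : s = s' → τ = τ') (c x x' : ℝ) :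
    orderedGreen (c - s) (c - s') (-conj τ) (-conj τ') x x' =
      conj (orderedGreen s s' τ τ' x x') := by
  rcases lt_trichotomy s s' with h1 | h1 | h1
  · have h2 : 0 ≤ (τ' - τ).re := by simpa using h h1.le
    simp only [orderedGreen, sub_le_sub_iff_left, h1.le, h1.not_ge, if_true, if_false,
      green_conj h2, map_sub]
    rw [← green_neg, neg_sub]
    congr 1
    ring
  · obtain rfl := heq h1
    subst h1
    simp [orderedGreen, green_conj]
  · have h2 : 0 ≤ (τ - τ').re := by simpa using h' h1.le
    simp only [orderedGreen, sub_le_sub_iff_left, h1.le, h1.not_ge, if_true, if_false,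
      green_conj h2, map_sub]
    rw [← green_neg, neg_sub]
    congr 1
    ring

/-! ### Reversal of the contour -/

lemma contour_re {k : ℕ} (t : Fin k → ℝ) (s : ℝ) :
    (contour t s).re = min s 0 + max (s - ((k : ℝ) - 1)) 0 := by
  simp only [contour, Complex.add_re, Complex.ofReal_re, Complex.mul_re, Complex.I_re,
    Complex.I_im, Complex.ofReal_im]
  ring

lemma contour_im {k : ℕ} (t : Fin k → ℝ) (s : ℝ) :
    (contour t s).im = timeAt t 0 + ∑ j ∈ Finset.range (k - 1),
      (timeAt t (j + 1) - timeAt t j) * max 0 (min 1 (s - j)) := by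
  simp only [contour, Complex.add_im, Complex.ofReal_re, Complex.mul_im, Complex.I_re,
    Complex.I_im, Complex.ofReal_im]
  ring

/-- This keeps every ordered difference along the contour in `Re τ ≥ 0`, where `green_conj` applies.
-/
lemma contour_re_mono {k : ℕ} (t : Fin k → ℝ) {s s' : ℝ} (h : s ≤ s') :
    (contour t s).re ≤ (contour t s').re := by
  rw [contour_re, contour_re]
  gcongr

lemma timeAt_rev {k : ℕ} (t : Fin k → ℝ) {j : ℕ} (hj : j < k) :
    timeAt (t ∘ Fin.rev) j = timeAt t (k - 1 - j) := by
  have h : k - 1 - j < k := by omega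
  simp only [timeAt, hj, h, dif_pos, Function.comp_apply]
  congr 1
  ext
  simp only [Fin.val_rev]
  omega

lemma clamp_one_sub (y : ℝ) : max 0 (min 1 (1 - y)) = 1 - max 0 (min 1 y) := by
  rcases le_total y 0 with h | h
  · rw [min_eq_left (by linarith), min_eq_right (by linarith), max_eq_right (by simp),
      max_eq_left h]; ring
  · rcases le_total y 1 with h' | h'
    · rw [min_eq_right (by linarith), min_eq_right h', max_eq_right (by linarith),
        max_eq_right h]
    · rw [min_eq_right (by linarith), min_eq_left h', max_eq_left (by linarith),
        max_eq_right (by simp)]; ring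

lemma contour_rev {k : ℕ} (t : Fin k → ℝ) (s : ℝ) :
    contour (t ∘ Fin.rev) ((k : ℝ) - 1 - s) = -conj (contour t s) := by
  apply Complex.ext
  · rw [contour_re, Complex.neg_re, Complex.conj_re, contour_re,
      show (k : ℝ) - 1 - s - ((k : ℝ) - 1) = -s by ring, neg_add, ← max_neg_neg, ← min_neg_neg,
      neg_zero, neg_sub]
    ring
  · rw [contour_im, Complex.neg_im, Complex.conj_im, contour_im, neg_neg]
    rcases Nat.eq_zero_or_pos k with rfl | hk
    · simp [timeAt]
    · obtain ⟨m, rfl⟩ : ∃ m, k = m + 1 := ⟨k - 1, by omega⟩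
      rw [timeAt_rev t hk]
      simp only [Nat.add_sub_cancel, Nat.sub_zero]
      -- Each reversed vertical segment contributes the original one minus its full increment; the
      -- increments telescope and turn the starting time `t_{k-1}` into `t_0`.
      rw [← Finset.sum_range_reflect]
      have h1 : ∀ j ∈ Finset.range m,
          (timeAt (t ∘ Fin.rev) (m - 1 - j + 1) - timeAt (t ∘ Fin.rev) (m - 1 - j)) *
            max 0 (min 1 (((m + 1 : ℕ) : ℝ) - 1 - s - ((m - 1 - j : ℕ) : ℝ))) =
          (timeAt t (j + 1) - timeAt t j) * max 0 (min 1 (s - j)) -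
            (timeAt t (j + 1) - timeAt t j) := by
        intro j hj
        have hj' := Finset.mem_range.mp hj
        rw [timeAt_rev t (by omega), timeAt_rev t (by omega)]
        have e1 : m + 1 - 1 - (m - 1 - j + 1) = j := by omega
        have e2 : m + 1 - 1 - (m - 1 - j) = j + 1 := by omega
        have e3 : ((m - 1 - j : ℕ) : ℝ) = m - 1 - j := by
          rw [Nat.cast_sub (by omega), Nat.cast_sub (by omega), Nat.cast_one]
        have e4 : ((m + 1 : ℕ) : ℝ) - 1 - s - ((m - 1 - j : ℕ) : ℝ) = 1 - (s - j) := by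
          rw [e3]; push_cast; ring
        rw [e1, e2, e4, clamp_one_sub]
        ring
      rw [Finset.sum_congr rfl h1, Finset.sum_sub_distrib, Finset.sum_range_sub]
      ring

/-- The sign from reversing the parameter cancels the sign in `-conj`. -/
lemma deriv_contour_rev {k : ℕ} (t : Fin k → ℝ) (s : ℝ) :
    deriv (contour (t ∘ Fin.rev)) ((k : ℝ) - 1 - s) = conj (deriv (contour t) s) := by
  have h : contour (t ∘ Fin.rev) =
      fun r => -((Complex.conjCLE : ℂ → ℂ) ∘ contour t) ((k : ℝ) - 1 - r) := by
    funext r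
    rw [← sub_sub_cancel ((k : ℝ) - 1) r, contour_rev]
    simp
  rw [h, deriv.fun_neg, deriv_comp_const_sub, neg_neg, sub_sub_cancel]
  -- Where the contour is not differentiable, neither is its reflection, and both derivatives take
  -- the default value `0`.
  by_cases hd : DifferentiableAt ℝ (contour t) s
  · exact ((Complex.conjCLE.hasFDerivAt).comp_hasDerivAt s hd.hasDerivAt).deriv
  · rw [deriv_zero_of_not_differentiableAt hd, deriv_zero_of_not_differentiableAt, map_zero]
    rwa [ContinuousLinearEquiv.comp_differentiableAt_iff]

/-- At parameter `i` the ramps with `j < i` are complete and the others have not begun, so the sum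
telescopes. External insertions thereby become contour points, subject to the same reflection. -/
lemma contour_natCast {k : ℕ} (t : Fin k → ℝ) (i : Fin k) :
    contour t ((i : ℕ) : ℝ) = Complex.I * t i := by
  have hk : ((i : ℕ) : ℝ) ≤ (k : ℝ) - 1 := by
    have : ((i : ℕ) : ℝ) + 1 ≤ k := by exact_mod_cast i.2
    linarith
  apply Complex.ext
  · rw [contour_re, min_eq_right (Nat.cast_nonneg _), max_eq_right (by linarith)]
    simp
  · rw [contour_im]
    have h1 : ∀ j ∈ Finset.range (k - 1),
        (timeAt t (j + 1) - timeAt t j) * max 0 (min 1 (((i : ℕ) : ℝ) - j)) =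
          if j < i then timeAt t (j + 1) - timeAt t j else 0 := by
      intro j _
      split_ifs with hj
      · have : (j : ℝ) + 1 ≤ ((i : ℕ) : ℝ) := by exact_mod_cast hj
        rw [min_eq_left (by linarith), max_eq_right zero_le_one, mul_one]
      · have : ((i : ℕ) : ℝ) ≤ j := by exact_mod_cast not_lt.mp hj
        rw [max_eq_left ((min_le_right _ _).trans (by linarith)), mul_zero]
    have h2 : (Finset.range (k - 1)).filter (· < (i : ℕ)) = Finset.range i := by
      ext j
      have := i.2
      simp only [Finset.mem_filter, Finset.mem_range]
      omega
    rw [Finset.sum_congr rfl h1, ← Finset.sum_filter, h2, Finset.sum_range_sub]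
    simp [timeAt]

lemma cast_rev {k : ℕ} (i : Fin k) : ((i.rev : ℕ) : ℝ) = (k : ℝ) - 1 - ((i : ℕ) : ℝ) := by
  rw [Fin.val_rev, Nat.cast_sub (by omega)]
  push_cast
  ring

/-! ### Conjugation of the screening integral and of the correlators -/

/-- The reflection of the contour parameters of the screening points. -/
noncomputable def screenReflect (k : ℕ) {w : ℕ} (p : Fin w → ℝ × ℝ) : Fin w → ℝ × ℝ :=
  fun l => ((k : ℝ) - 1 - (p l).1, (p l).2)

lemma screeningIntegrand_rev (b : ℝ) {k w : ℕ} (α t x : Fin k → ℝ) (p : Fin w → ℝ × ℝ) :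
    screeningIntegrand b (fun j => (α j.rev : ℂ)) (t ∘ Fin.rev) (x ∘ Fin.rev)
        (screenReflect k p) =
      conj (screeningIntegrand b (fun j => (α j : ℂ)) t x p) := by
  simp only [screeningIntegrand, map_mul, map_prod, ← Complex.exp_conj, map_sub, map_sum, map_neg,
    map_pow, Complex.conj_ofReal, Complex.conj_ofNat, screenReflect, deriv_contour_rev,
    contour_rev]
  congr 3
  · congr 1
    -- Only the external insertions are relabelled; the screening points keep their labels.
    rw [← Equiv.sum_comp Fin.revPerm]
    refine Finset.sum_congr rfl fun j _ => Finset.sum_congr rfl fun l _ => ?_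
    simp only [Fin.revPerm_apply, Fin.rev_rev, Function.comp_apply, cast_rev]
    congr 1
    have h := orderedGreen_reflect (contour_re_mono t) (contour_re_mono t)
      (s := ((j : ℕ) : ℝ)) (s' := (p l).1) (fun h => by rw [h]) ((k : ℝ) - 1) (x j) (p l).2
    rw [contour_natCast] at h
    simpa using h
  · congr 1
    refine Finset.sum_congr rfl fun l _ => Finset.sum_congr rfl fun l' _ => ?_
    exact orderedGreen_reflect (contour_re_mono t) (contour_re_mono t) (fun h => by rw [h]) _ _ _

/-- Reversal sends a pair `j < j'` to a pair in the opposite order, whence the exchanged arguments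
on the right. -/
lemma sum_Ioi_rev {k : ℕ} (F : Fin k → Fin k → ℂ) :
    ∑ j : Fin k, ∑ j' ∈ Finset.Ioi j, F j.rev j'.rev =
      ∑ j : Fin k, ∑ j' ∈ Finset.Ioi j, F j' j := by
  have h1 : ∀ G : Fin k → Fin k → ℂ, ∑ j : Fin k, ∑ j' ∈ Finset.Ioi j, G j j' =
      ∑ j : Fin k, ∑ j' : Fin k, if j < j' then G j j' else 0 := by
    intro G
    refine Finset.sum_congr rfl fun j _ => ?_
    rw [← Finset.sum_filter]
    congr 1
    ext; simp
  rw [h1, h1 fun j j' => F j' j, ← Equiv.sum_comp Fin.revPerm, Finset.sum_comm]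
  rw [← Equiv.sum_comp Fin.revPerm]
  simp

lemma measurePreserving_screenReflect (k w : ℕ) :
    MeasureTheory.MeasurePreserving (screenReflect k (w := w))
      (MeasureTheory.Measure.pi fun _ => cylMeasure)
      (MeasureTheory.Measure.pi fun _ => cylMeasure) := by
  have hc : cylMeasure = (MeasureTheory.volume : MeasureTheory.Measure ℝ).prod
      (MeasureTheory.volume.restrict (Set.Icc (-1 : ℝ) 1)) := by
    rw [cylMeasure, MeasureTheory.Measure.volume_eq_prod, ← MeasureTheory.Measure.prod_restrict,
      MeasureTheory.Measure.restrict_univ]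
  have : MeasureTheory.SigmaFinite cylMeasure := by rw [hc]; infer_instance
  have h : MeasureTheory.MeasurePreserving
      (fun q : ℝ × ℝ => ((k : ℝ) - 1 - q.1, q.2)) cylMeasure cylMeasure := by
    rw [hc]
    exact (MeasureTheory.Measure.measurePreserving_sub_left MeasureTheory.volume ((k : ℝ) - 1)).prod
      (MeasureTheory.MeasurePreserving.id _)
  exact MeasureTheory.measurePreserving_pi (fun _ : Fin w => cylMeasure)
    (fun _ : Fin w => cylMeasure) (fun _ => h)

lemma screenReflect_involutive (k w : ℕ) : Function.Involutive (screenReflect k (w := w)) := by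
  intro p
  funext l
  simp [screenReflect]

lemma lorentzCorr_rev (b μ : ℝ) {k : ℕ} (w : ℕ) (α t x : Fin k → ℝ) :
    lorentzCorr b μ w (fun j => (α j.rev : ℂ)) (t ∘ Fin.rev) (x ∘ Fin.rev) =
      conj (lorentzCorr b μ w (fun j => (α j : ℂ)) t x) := by
  have hm := measurePreserving_screenReflect k w
  let e : (Fin w → ℝ × ℝ) ≃ᵐ (Fin w → ℝ × ℝ) :=
    { (screenReflect_involutive k w).toPerm with
      measurable_toFun := hm.measurable
      measurable_invFun := hm.measurable }
  have hi := MeasureTheory.MeasurePreserving.integral_comp' (f := e) hm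
    (screeningIntegrand b (fun j => (α j.rev : ℂ)) (t ∘ Fin.rev) (x ∘ Fin.rev))
  have hi' : ∀ p, screeningIntegrand b (fun j => (α j.rev : ℂ)) (t ∘ Fin.rev) (x ∘ Fin.rev)
      (e p) = conj (screeningIntegrand b (fun j => (α j : ℂ)) t x p) :=
    screeningIntegrand_rev b α t x
  simp only [hi', integral_conj] at hi
  simp only [lorentzCorr, map_mul, map_div₀, map_pow, map_neg, map_sum, ← hi, ← Complex.exp_conj,
    Complex.conj_ofReal, Complex.conj_ofNat, Complex.conj_natCast]
  congr 4
  have h := sum_Ioi_rev fun j j' => (α j : ℂ) * α j' * orderedGreen ((j.rev : ℕ) : ℝ)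
    ((j'.rev : ℕ) : ℝ) (Complex.I * t j) (Complex.I * t j') (x j) (x j')
  simp only [Fin.rev_rev] at h
  refine h.trans (Finset.sum_congr rfl fun j _ => Finset.sum_congr rfl fun j' hj => ?_)
  rw [mul_comm (α j' : ℂ)]
  congr 1
  -- Distinct insertions have distinct parameters even when their times coincide, so the tie
  -- conditions are vacuous.
  have hne : ((j : ℕ) : ℝ) ≠ ((j' : ℕ) : ℝ) := by
    have := Finset.mem_Ioi.mp hj
    exact_mod_cast (show (j : ℕ) < j' from this).ne
  rw [orderedGreen_swap (by rw [cast_rev, cast_rev]; intro h; exact absurd (by linarith) hne),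
    cast_rev, cast_rev, ← orderedGreen_reflect (c := (k : ℝ) - 1) (by simp) (by simp)
      (fun h => absurd h hne)]
  simp

lemma chargeCorr_rev (b μ : ℝ) {k : ℕ} (n : Fin k → Charge b) (u : Fin k → ℝ × ℝ) :
    chargeCorr b μ (n ∘ Fin.rev) (u ∘ Fin.rev) = conj (chargeCorr b μ n u) := by
  have hs : ∑ j : Fin k, (((n ∘ Fin.rev) j : Charge b) : ℤ) = ∑ j, (n j : ℤ) :=
    Equiv.sum_comp Fin.revPerm fun j => (n j : ℤ)
  rw [chargeCorr, chargeCorr, hs]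
  split_ifs with h
  · exact lorentzCorr_rev b μ _ (fun j => b * (n j : ℤ)) (fun j => (u j).1) (fun j => (u j).2)
  · simp

/-! ### Hermiticity of the vacuum functional -/

lemma conjTest_conjTest (f : TestFn) : conjTest (conjTest f) = f := by
  apply Subtype.ext
  funext u
  simp [conjTest]

lemma smearedIntegrand_rev (b μ : ℝ) {k : ℕ} (n : Fin k → Charge b) (f : Fin k → TestFn)
    (u : Fin k → ℝ × ℝ) :
    smearedIntegrand b μ (n ∘ Fin.rev) (fun j => conjTest (f j.rev)) (u ∘ Fin.rev) =
      conj (smearedIntegrand b μ n f u) := by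
  rw [smearedIntegrand, smearedIntegrand, chargeCorr_rev, map_mul, map_prod]
  congr 1
  exact Equiv.prod_comp Fin.revPerm fun j => conj ((f j).1 (cylProj (u j)))

/-- Reversing the order of the points of `M^k`. -/
noncomputable def revPoints (k : ℕ) : (Fin k → ℝ × ℝ) ≃ᵐ (Fin k → ℝ × ℝ) :=
  MeasurableEquiv.arrowCongr' Fin.revPerm (MeasurableEquiv.refl (ℝ × ℝ))

lemma measurePreserving_revPoints (k : ℕ) :
    MeasureTheory.MeasurePreserving (revPoints k) (cylPow k) (cylPow k) := by
  have : MeasureTheory.SigmaFinite cylMeasure := by rw [cylMeasure]; infer_instance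
  exact MeasureTheory.measurePreserving_arrowCongr' (fun _ : Fin k => cylMeasure)
    (fun _ : Fin k => cylMeasure) Fin.revPerm (MeasurableEquiv.refl (ℝ × ℝ))
    fun _ => MeasureTheory.MeasurePreserving.id _

lemma integrable_smearedIntegrand_rev (b μ : ℝ) {k : ℕ} (n : Fin k → Charge b)
    (f : Fin k → TestFn) (h : MeasureTheory.Integrable (smearedIntegrand b μ n f) (cylPow k)) :
    MeasureTheory.Integrable
      (smearedIntegrand b μ (n ∘ Fin.rev) (fun j => conjTest (f j.rev))) (cylPow k) := by
  rw [← (measurePreserving_revPoints k).integrable_comp_emb (revPoints k).measurableEmbedding]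
  refine (Complex.conjCLE.integrable_comp_iff.mpr h).congr (.of_forall fun u => ?_)
  exact (smearedIntegrand_rev b μ n f u).symm

lemma integrable_smearedIntegrand_rev_iff (b μ : ℝ) {k : ℕ} (n : Fin k → Charge b) :
    (∀ f, MeasureTheory.Integrable (smearedIntegrand b μ (n ∘ Fin.rev) f) (cylPow k)) ↔
      ∀ f, MeasureTheory.Integrable (smearedIntegrand b μ n f) (cylPow k) := by
  have h : ∀ n : Fin k → Charge b,
      (∀ f, MeasureTheory.Integrable (smearedIntegrand b μ n f) (cylPow k)) →
      ∀ f, MeasureTheory.Integrable (smearedIntegrand b μ (n ∘ Fin.rev) f) (cylPow k) := by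
    intro n hn f
    simpa only [Fin.rev_rev, conjTest_conjTest] using
      integrable_smearedIntegrand_rev b μ n (fun j => conjTest (f j.rev)) (hn _)
  refine ⟨fun hn => ?_, h n⟩
  have h2 := h _ hn
  rwa [Function.comp_assoc, Fin.rev_involutive.comp_self, Function.comp_id] at h2

lemma smearedCorr_rev (b μ : ℝ) {k : ℕ} (n : Fin k → Charge b) (f : Fin k → TestFn) :
    smearedCorr b μ (n ∘ Fin.rev) (fun j => conjTest (f j.rev)) =
      conj (smearedCorr b μ n f) := by
  by_cases h : ∀ f, MeasureTheory.Integrable (smearedIntegrand b μ n f) (cylPow k)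
  · rw [smearedCorr, smearedCorr, dif_pos h,
      dif_pos ((integrable_smearedIntegrand_rev_iff b μ n).mpr h)]
    change ∫ u, _ ∂_ = conj (∫ u, _ ∂_)
    rw [← integral_conj, ← (measurePreserving_revPoints k).integral_comp']
    exact MeasureTheory.integral_congr_ae (.of_forall fun u => smearedIntegrand_rev b μ n f u)
  -- Without absolute convergence, both sides are `0` by convention.
  · rw [smearedCorr, smearedCorr, dif_neg h,
      dif_neg (mt (integrable_smearedIntegrand_rev_iff b μ n).mp h)]
    simp

lemma vacuumDeg_rev (b μ : ℝ) (k : ℕ) (g : Fin k → Gen b) :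
    vacuumDeg b μ k (fun j m => conjTest (g j.rev m)) = conj (vacuumDeg b μ k g) := by
  simp only [vacuumDeg, sum_apply, map_sum, MultilinearMap.compLinearMap_apply,
    LinearMap.proj_apply]
  rw [← Equiv.sum_comp (Equiv.arrowCongr Fin.revPerm (Equiv.refl (Charge b)))]
  exact Finset.sum_congr rfl fun n _ => smearedCorr_rev b μ n fun j => g j (n j)

lemma vacuum_tprod (b μ : ℝ) {k : ℕ} (g : Fin k → Gen b) :
    vacuum b μ (TensorAlgebra.tprod ℂ (Gen b) k g) = vacuumDeg b μ k g := by
  have h3 : TensorAlgebra.equivDirectSum (TensorAlgebra.tprod ℂ (Gen b) k g) =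
      DirectSum.of (fun k => ⨂[ℂ]^k (Gen b)) k (PiTensorProduct.tprod ℂ g) :=
    TensorAlgebra.toDirectSum_tensorPower_tprod _
  rw [vacuum, LinearMap.comp_apply, AlgEquiv.toLinearMap_apply, h3, ← DirectSum.lof_eq_of ℂ,
    DirectSum.toModule_lof, PiTensorProduct.lift.tprod]

/-! ### The involution on pure tensors -/

lemma star_smul_obsAlg {b : ℝ} (c : ℂ) (A : ObsAlg b) : star (c • A) = conj c • star A := by
  rw [Algebra.smul_def, star_mul_obsAlg, star_algebraMap_obsAlg, Algebra.smul_def,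
    Algebra.commutes]

lemma star_one_obsAlg {b : ℝ} : star (1 : ObsAlg b) = 1 := by
  simpa using star_algebraMap_obsAlg (b := b) 1

lemma star_ι_obsAlg {b : ℝ} (g : Gen b) :
    star (TensorAlgebra.ι ℂ g : ObsAlg b) = TensorAlgebra.ι ℂ fun n => conjTest (g n) := by
  change MulOpposite.unop (TensorAlgebra.lift ℂ (genStar b) (TensorAlgebra.ι ℂ g)) = _
  rw [TensorAlgebra.lift_ι_apply]
  rfl

lemma star_star_obsAlg {b : ℝ} (A : ObsAlg b) : star (star A) = A := by
  induction A using TensorAlgebra.induction with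
  | algebraMap c => rw [star_algebraMap_obsAlg, star_algebraMap_obsAlg, Complex.conj_conj]
  | ι g => simp only [star_ι_obsAlg, conjTest_conjTest]
  | mul A B hA hB => rw [star_mul_obsAlg, star_mul_obsAlg, hA, hB]
  | add A B hA hB => rw [star_add_obsAlg, star_add_obsAlg, hA, hB]

lemma star_list_prod_obsAlg {b : ℝ} (l : List (ObsAlg b)) :
    star l.prod = (l.map star).reverse.prod := by
  induction l with
  | nil => simp [star_one_obsAlg]
  | cons A l ih => simp [star_mul_obsAlg, ih]

lemma star_tprod_obsAlg {b : ℝ} {k : ℕ} (g : Fin k → Gen b) :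
    star (TensorAlgebra.tprod ℂ (Gen b) k g) =
      TensorAlgebra.tprod ℂ (Gen b) k (fun j m => conjTest (g j.rev m)) := by
  rw [TensorAlgebra.tprod_apply, TensorAlgebra.tprod_apply, star_list_prod_obsAlg, List.map_ofFn]
  congr 1
  refine List.ext_getElem (by simp) fun i h1 h2 => ?_
  simp only [List.getElem_reverse, List.getElem_ofFn, List.length_ofFn, Function.comp_apply,
    star_ι_obsAlg]
  congr! 4
  ext
  simp only [Fin.val_rev]
  omega

/-- Since `ω` is not multiplicative, hermiticity cannot be checked on generators alone; it is
checked on pure tensors and extended by conjugate-linearity. -/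
lemma span_range_tprod_obsAlg (b : ℝ) :
    Submodule.span ℂ {A : ObsAlg b | ∃ k g, TensorAlgebra.tprod ℂ (Gen b) k g = A} = ⊤ := by
  rw [eq_top_iff]
  rintro A -
  obtain ⟨x, rfl⟩ := TensorAlgebra.equivDirectSum.symm.surjective A
  induction x using DirectSum.induction_on with
  | zero => simp
  | add x y hx hy => rw [map_add]; exact add_mem hx hy
  | of k x =>
    induction x using PiTensorProduct.induction_on with
    | smul_tprod c g =>
      rw [← DirectSum.lof_eq_of ℂ, map_smul, map_smul, DirectSum.lof_eq_of]
      refine Submodule.smul_mem _ _ (Submodule.subset_span ⟨k, g, ?_⟩)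
      exact (TensorAlgebra.ofDirectSum_of_tprod g).symm
    | add x y hx hy => rw [map_add, map_add]; exact add_mem hx hy

/-- The vacuum functional is Hermitian. -/
lemma vacuum_star (b μ : ℝ) (A : ObsAlg b) : vacuum b μ (star A) = conj (vacuum b μ A) := by
  have hA : A ∈ Submodule.span ℂ
      {A : ObsAlg b | ∃ k g, TensorAlgebra.tprod ℂ (Gen b) k g = A} := by
    rw [span_range_tprod_obsAlg]; trivial
  induction hA using Submodule.span_induction with
  | mem A h =>
    obtain ⟨k, g, rfl⟩ := h
    rw [star_tprod_obsAlg, vacuum_tprod, vacuum_tprod, vacuumDeg_rev]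
  | zero => rw [← zero_smul ℂ (1 : ObsAlg b), star_smul_obsAlg]; simp
  | add A B _ _ hA hB => rw [star_add_obsAlg, map_add, map_add, map_add, hA, hB]
  | smul c A _ hA =>
    rw [star_smul_obsAlg, map_smul, map_smul, hA, smul_eq_mul, smul_eq_mul, map_mul]

/-! ### The state space -/

variable {b μ : ℝ}

lemma coeffMap_apply (A B : ObsAlg b) : coeffMap b μ A B = vacuum b μ (star B * A) := rfl

lemma stateVec_apply (A B : ObsAlg b) :
    (stateVec b μ A : ObsAlg b → ℂ) B = vacuum b μ (star B * A) := rfl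

/-- A closed condition holds on `ℋ` if it holds on `Φ(𝒜)`. -/
lemma stateSpace_induction {P : (ObsAlg b → ℂ) → Prop} (hP : IsClosed {z | P z})
    (h : ∀ A, P (coeffMap b μ A)) (z : stateSpace b μ) : P z :=
  closure_minimal (by rintro _ ⟨A, rfl⟩; exact h A) hP z.2

lemma stateSpace_apply_add (z : stateSpace b μ) (A B : ObsAlg b) :
    (z : ObsAlg b → ℂ) (A + B) = (z : ObsAlg b → ℂ) A + (z : ObsAlg b → ℂ) B := by
  refine stateSpace_induction (P := fun z => z (A + B) = z A + z B)
    (isClosed_eq (continuous_apply _) (by fun_prop))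
    (fun C => ?_) z
  simp only [coeffMap_apply, star_add_obsAlg, add_mul, map_add]

/-- This conjugate-linearity cancels that of `C ↦ C*`, which makes `π` complex linear in `C`. -/
lemma stateSpace_apply_smul (z : stateSpace b μ) (c : ℂ) (A : ObsAlg b) :
    (z : ObsAlg b → ℂ) (c • A) = conj c * (z : ObsAlg b → ℂ) A := by
  refine stateSpace_induction (P := fun z => z (c • A) = conj c * z A)
    (isClosed_eq (continuous_apply _) (continuous_const.mul (continuous_apply A)))
    (fun C => ?_) z
  simp only [coeffMap_apply, star_smul_obsAlg, smul_mul_assoc, map_smul, smul_eq_mul]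

lemma coeffMap_conj_symm (A B : ObsAlg b) : coeffMap b μ A B = conj (coeffMap b μ B A) := by
  rw [coeffMap_apply, coeffMap_apply, ← vacuum_star, star_mul_obsAlg, star_star_obsAlg]

/-- The coordinates of a state at `A` depend only on `Φ(A)`. -/
lemma stateSpace_apply_congr {A A' : ObsAlg b} (h : stateVec b μ A = stateVec b μ A')
    (z : stateSpace b μ) : (z : ObsAlg b → ℂ) A = (z : ObsAlg b → ℂ) A' := by
  have h' : coeffMap b μ A = coeffMap b μ A' := congrArg Subtype.val h
  refine stateSpace_induction (P := fun z => z A = z A')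
    (isClosed_eq (continuous_apply _) (continuous_apply _)) (fun C => ?_) z
  -- Hermiticity moves `A` from the index to the vector, where the hypothesis applies.
  rw [coeffMap_conj_symm, h', ← coeffMap_conj_symm]

lemma pairing_coreVec (A : ObsAlg b) (z : stateSpace b μ) :
    pairing (coreVec b μ A) z = (z : ObsAlg b → ℂ) A :=
  stateSpace_apply_congr
    (Classical.choose_spec (LinearMap.mem_range.mp (coreVec b μ A).2)) z

/-! ### The representation by shifts -/

/-- The operator `z ↦ (z_{C^* A})_A` on `ℂ^𝒜`. -/
noncomputable def shift (C : ObsAlg b) : (ObsAlg b → ℂ) →L[ℂ] (ObsAlg b → ℂ) :=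
  ContinuousLinearMap.pi fun A => ContinuousLinearMap.proj (star C * A)

lemma shift_apply (C : ObsAlg b) (z : ObsAlg b → ℂ) (A : ObsAlg b) :
    shift C z A = z (star C * A) := rfl

lemma shift_coeffMap (C A : ObsAlg b) : shift C (coeffMap b μ A) = coeffMap b μ (C * A) := by
  funext B
  rw [shift_apply, coeffMap_apply, coeffMap_apply, star_mul_obsAlg, star_star_obsAlg, mul_assoc]

/-- The preimage of the closed space `ℋ` under the continuous shift is closed, and it contains each
`Φ(A)`, whose image is `Φ(CA)`. -/
lemma shift_mem_stateSpace (C : ObsAlg b) (z : stateSpace b μ) :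
    shift C (z : ObsAlg b → ℂ) ∈ stateSpace b μ := by
  refine stateSpace_induction (P := fun z => shift C z ∈ stateSpace b μ)
    ((Submodule.isClosed_topologicalClosure _).preimage (shift C).continuous) (fun A => ?_) z
  rw [shift_coeffMap]
  exact (stateVec b μ (C * A)).2

/-- The operator `π(C)` on `ℋ`. -/
noncomputable def repOp (μ : ℝ) (C : ObsAlg b) : stateSpace b μ →L[ℂ] stateSpace b μ :=
  ((shift C).comp (stateSpace b μ).subtypeL).codRestrict _ (shift_mem_stateSpace C)

lemma repOp_apply (C : ObsAlg b) (z : stateSpace b μ) (A : ObsAlg b) :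
    (repOp μ C z : ObsAlg b → ℂ) A = (z : ObsAlg b → ℂ) (star C * A) := rfl

lemma repOp_stateVec (C A : ObsAlg b) :
    repOp μ C (stateVec b μ A) = stateVec b μ (C * A) :=
  Subtype.ext (shift_coeffMap C A)

/-- The representation `π` of `𝒜` on `ℋ`. -/
noncomputable def stateRep (b μ : ℝ) : ObsAlg b →ₐ[ℂ] (stateSpace b μ →L[ℂ] stateSpace b μ) :=
  AlgHom.ofLinearMap
    { toFun := repOp μ
      map_add' := by
        intro C D
        ext z A
        rw [repOp_apply, star_add_obsAlg, add_mul, stateSpace_apply_add]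
        rfl
      map_smul' := by
        intro c C
        ext z A
        rw [repOp_apply, star_smul_obsAlg, smul_mul_assoc, stateSpace_apply_smul,
          Complex.conj_conj]
        rfl }
    (by
      ext z A
      change (repOp μ 1 z : ObsAlg b → ℂ) A = (z : ObsAlg b → ℂ) A
      rw [repOp_apply, star_one_obsAlg, one_mul])
    (by
      intro C D
      ext z A
      change (repOp μ (C * D) z : ObsAlg b → ℂ) A = (repOp μ C (repOp μ D z) : ObsAlg b → ℂ) A
      rw [repOp_apply, repOp_apply, repOp_apply, star_mul_obsAlg, mul_assoc])

lemma stateRep_apply (C : ObsAlg b) (z : stateSpace b μ) (A : ObsAlg b) :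
    (stateRep b μ C z : ObsAlg b → ℂ) A = (z : ObsAlg b → ℂ) (star C * A) := rfl

lemma stateRep_stateVec (C A : ObsAlg b) :
    stateRep b μ C (stateVec b μ A) = stateVec b μ (C * A) :=
  repOp_stateVec C A

lemma stateRep_vacuumVec (C : ObsAlg b) :
    stateRep b μ C (vacuumVec b μ : stateSpace b μ) = stateVec b μ C := by
  change stateRep b μ C (stateVec b μ 1) = _
  rw [stateRep_stateVec, mul_one]

lemma span_range_stateRep_vacuumVec (b μ : ℝ) :
    Submodule.span ℂ
      (Set.range fun C : ObsAlg b => stateRep b μ C (vacuumVec b μ : stateSpace b μ)) =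
        core b μ := by
  simp only [stateRep_vacuumVec]
  exact Submodule.span_eq (core b μ)

lemma dense_core (b μ : ℝ) : Dense (core b μ : Set (stateSpace b μ)) := by
  intro z
  rw [closure_subtype]
  refine closure_mono ?_ z.2
  rintro _ ⟨A, rfl⟩
  exact ⟨stateVec b μ A, ⟨A, rfl⟩, rfl⟩

end TimelikeLiouville

theorem theorem2p11 (b μ : ℝ) (hb : 0 < b) (hb' : b < 1 / Real.sqrt 2) (hμ : 0 < μ) :
    -- the pairing `(Φ(A), z) = z_A` is well defined
    (∀ (A : ObsAlg b) (z : stateSpace b μ),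
      pairing (coreVec b μ A) z = (z : ObsAlg b → ℂ) A) ∧
    -- `π` is a unital representation by continuous linear maps on `ℋ`
    ∃ rep : ObsAlg b →ₐ[ℂ] (stateSpace b μ →L[ℂ] stateSpace b μ),
      (∀ (C : ObsAlg b) (z : stateSpace b μ) (A : ObsAlg b),
        (rep C z : ObsAlg b → ℂ) A = (z : ObsAlg b → ℂ) (star C * A)) ∧
      (∀ C A : ObsAlg b, rep C (stateVec b μ A) = stateVec b μ (C * A)) ∧
      -- `π(C)` preserves `ℋ₀`, and `(π(C)u, z) = (u, π(C^*)z)`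
      (∀ (C : ObsAlg b) (u : core b μ),
        ∃ hu : rep C (u : stateSpace b μ) ∈ core b μ,
          ∀ z : stateSpace b μ,
            pairing ⟨rep C (u : stateSpace b μ), hu⟩ z = pairing u (rep (star C) z)) ∧
      -- `Ω` is cyclic
      Submodule.span ℂ (Set.range fun C : ObsAlg b => rep C (vacuumVec b μ : stateSpace b μ))
        = core b μ ∧
      Dense (Submodule.span ℂ
        (Set.range fun C : ObsAlg b => rep C (vacuumVec b μ : stateSpace b μ)) :
          Set (stateSpace b μ)) ∧
      -- `Ω` reproduces the vacuum functional
      (∀ A : ObsAlg b, vacuum b μ A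
        = pairing (vacuumVec b μ) (rep A (vacuumVec b μ : stateSpace b μ))) := by
  refine ⟨pairing_coreVec, stateRep b μ, stateRep_apply, stateRep_stateVec, ?_,
    span_range_stateRep_vacuumVec b μ, ?_, fun A => ?_⟩
  · rintro C ⟨_, A, rfl⟩
    refine ⟨⟨C * A, (stateRep_stateVec C A).symm⟩, fun z => ?_⟩
    have h : (⟨stateRep b μ C (stateVec b μ A), ⟨C * A, (stateRep_stateVec C A).symm⟩⟩ :
        core b μ) = coreVec b μ (C * A) := Subtype.ext (stateRep_stateVec C A)
    refine (congrArg (fun u => pairing u z) h).trans ?_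
    refine (pairing_coreVec _ _).trans (Eq.trans ?_ (pairing_coreVec A _).symm)
    -- Both sides are the coordinate `z_{CA}`, because `C** = C`.
    rw [stateRep_apply, star_star_obsAlg]
  · rw [span_range_stateRep_vacuumVec]
    exact dense_core b μ
  · rw [stateRep_vacuumVec, vacuumVec, pairing_coreVec, stateVec_apply, star_one_obsAlg, one_mul]
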